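/- Let $\mathfrak H$ be a complex Hilbert space with orthonormal basis $(\phi_k)_{k\ge 0}$. Let $a, a^\dagger$ be the usual annihilation and creation operators, $a\phi_k=\sqrt k\,\phi_{k-1}$ and $a^\dagger\phi_k=\sqrt{k+1}\,\phi_{k+1}$, on their natural domain $\{x:\sum_k k|\langle\phi_k|x\rangle|^2<\infty\}$. For an operator $A$ whose closure generates a (unique) strongly continuous one-parameter group of bounded operators, let $e^{A}$ denote the value of that group at time $1$. Let $(\chi^i)_{i=1}^n$ be an orthonormal basis of $\mathbb C^n$, let $\mathfrak Z$ be a normal $n\times n$ complex matrix, and define the canonical normal-matrix vector coherent states (VCS) $$|\mathfrak Z;i\rangle = e^{-\frac12\operatorname{Tr}[|\mathfrak Z|^2]}\sum_{k=0}^\infty \frac{\mathfrak Z^k}{\sqrt{k!}}\,\chi^i\otimes\phi_k\in\mathbb C^n\otimes\mathfrak H,\qquad |\mathfrak Z|^2=\mathfrak Z\mathfrak Z^*.$$ Then: 1. The series above converge. The closure of $\mathfrak Z\otimes a^\dagger-\mathfrak Z^*\otimes a$ generates a unique strongly continuous one-parameter group on $\mathbb C^n\otimes\mathfrak H$, and the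 matrix displacement operator $\mathbb D(\mathfrak Z):=e^{\mathfrak Z\otimes a^\dagger-\mathfrak Z^*\otimes a}$ is unitary. Likewise, for every $z\in\mathbb C$ the closure of $za^\dagger-\bar z a$ generates a unique such group on $\mathfrak H$, so the displacement operator $D(z)=e^{za^\dagger-\bar z a}$ is well defined. 2. $\mathfrak Z$ has a decomposition $\mathfrak Z=V\operatorname{diag}(z_1,\dots,z_n)V^*$ with $V\in U(n)$, $z_j=r_je^{i\theta_j}$, $r_j\ge0$, $0\le\theta_j<2\pi$, and for every such decomposition $$|\mathfrak Z;i\rangle=e^{-\frac12VTV^*}\,\mathbb D(\mathfrak Z)\,\chi^i\otimes\phi_0\quad(i=1,\dots,n),\qquad \mathbb D(\mathfrak Z)=V\operatorname{diag}\big(D(z_1),\dots,D(z_n)\big)V^*,$$ where $T=\operatorname{diag}(a_1,\dots,a_n)$ with $a_i=\sum_{j=1}^n r_j^2-r_i^2$, and matrices act on the first tensor factor. -/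

import Mathlib

open scoped TensorProduct ComplexConjugate Matrix

noncomputable section

namespace VCS

/-! ### Exponentials of unbounded operators -/

section Exp

variable {E : Type*} [NormedAddCommGroup E] [NormedSpace ℂ E]

/-- A strongly continuous one-parameter group of bounded operators on `E`. -/
@[ext]
structure C0Group (E : Type*) [NormedAddCommGroup E] [NormedSpace ℂ E] where
  op : ℝ → E →L[ℂ] E
  op_zero : op 0 = ContinuousLinearMap.id ℂ E
  op_add : ∀ s t, op (s + t) = (op s).comp (op t)
  continuous_op : ∀ x, Continuous fun t => op t x

/-- The graph of the infinitesimal generator of a strongly continuous one-parameter group: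
all pairs `(x, y)` such that `t ↦ T(t) x` is differentiable at `0` with derivative `y`. -/
def C0Group.generatorGraph (T : C0Group E) : Set (E × E) :=
  {p | HasDerivAt (fun t : ℝ => T.op t p.1) p.2 0}

/-- `T` is the group `t ↦ exp (t A)`: its generator is the closure of the operator `A`. -/
def C0Group.IsGeneratedBy (T : C0Group E) (A : E →ₗ.[ℂ] E) : Prop :=
  T.generatorGraph = closure (A.graph : Set (E × E))

open Classical in
/-- The exponential `e^A` of an (in general unbounded) operator `A`: the value at time `1` of the
strongly continuous one-parameter group whose generator is the closure of `A`.
(The value is `0` if there is no such group.) -/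
def opExp (A : E →ₗ.[ℂ] E) : E →L[ℂ] E :=
  if h : ∃! T : C0Group E, T.IsGeneratedBy A then h.choose.op 1 else 0

end Exp

/-! ### Creation and annihilation operators -/

section Ladder

variable {H : Type*} [NormedAddCommGroup H] [InnerProductSpace ℂ H]
variable (φ : HilbertBasis ℕ ℂ H)

/-- The natural domain of the creation and annihilation operators: all `x = ∑ x_k φ_k` with
`∑ k |x_k|² < ∞`. -/
def ladderDomain : Submodule ℂ H where
  carrier := {x | Summable fun k : ℕ => (k : ℝ) * ‖φ.repr x k‖ ^ 2}
  zero_mem' := by simp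
  add_mem' := by
    intro x y hx hy
    refine Summable.of_nonneg_of_le (fun k => by positivity) (fun k => ?_)
      ((hx.add hy).mul_left 2)
    have h1 : ‖φ.repr (x + y) k‖ ≤ ‖φ.repr x k‖ + ‖φ.repr y k‖ := by
      simpa using norm_add_le (φ.repr x k) (φ.repr y k)
    have h2 : ‖φ.repr (x + y) k‖ ^ 2 ≤ 2 * (‖φ.repr x k‖ ^ 2 + ‖φ.repr y k‖ ^ 2) := by
      nlinarith [norm_nonneg (φ.repr (x + y) k), sq_nonneg (‖φ.repr x k‖ - ‖φ.repr y k‖),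
        norm_nonneg (φ.repr x k), norm_nonneg (φ.repr y k)]
    have h3 : (0 : ℝ) ≤ k := Nat.cast_nonneg k
    nlinarith [mul_le_mul_of_nonneg_left h2 h3]
  smul_mem' := by
    intro c x hx
    refine (Summable.mul_left (‖c‖ ^ 2) hx).congr (fun k => ?_)
    simp only [map_smul, lp.coeFn_smul, Pi.smul_apply, norm_smul]
    ring

lemma memlp_annih (x : ladderDomain φ) :
    Memℓp (fun k : ℕ => (Real.sqrt (k + 1) : ℂ) * φ.repr (x : H) (k + 1)) 2 := by
  rw [memℓp_gen_iff (by norm_num)]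
  have h : Summable fun k : ℕ => (k : ℝ) * ‖φ.repr (x : H) k‖ ^ 2 := x.2
  refine ((summable_nat_add_iff 1).2 h).congr (fun k => ?_)
  have hk : (0 : ℝ) ≤ (k : ℝ) + 1 := by positivity
  simp [mul_pow, abs_of_nonneg, Real.sq_sqrt hk]

lemma memlp_creat (x : ladderDomain φ) :
    Memℓp (fun k : ℕ => (Real.sqrt k : ℂ) * φ.repr (x : H) (k - 1)) 2 := by
  rw [memℓp_gen_iff (by norm_num)]
  have h : Summable fun k : ℕ => (k : ℝ) * ‖φ.repr (x : H) k‖ ^ 2 := x.2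
  have h' : Summable fun k : ℕ => ‖φ.repr (x : H) k‖ ^ 2 := by
    have := (memℓp_gen_iff (p := 2) (by norm_num)).1 (lp.memℓp (φ.repr (x : H)))
    simpa using this
  refine (summable_nat_add_iff 1).1 ((h.add h').congr (fun k => ?_))
  have hk : (0 : ℝ) ≤ (k : ℝ) + 1 := by positivity
  simp [mul_pow, abs_of_nonneg, Real.sq_sqrt hk]
  ring

/-- The annihilation operator `a`, with `a φ_k = √k φ_{k-1}`, on its natural domain: the `k`-th
coefficient of `a x` is `√(k+1) x_{k+1}`. -/
def annih : H →ₗ.[ℂ] H where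
  domain := ladderDomain φ
  toFun :=
    { toFun := fun x => φ.repr.symm ⟨_, memlp_annih φ x⟩
      map_add' := by
        intro x y
        rw [← map_add]
        congr 1
        ext k
        simp [mul_add]
        rfl
      map_smul' := by
        intro c x
        rw [RingHom.id_apply, ← map_smul]
        congr 1
        ext k
        simp [mul_left_comm] }

/-- The creation operator `a†`, with `a† φ_k = √(k+1) φ_{k+1}`, on its natural domain: the `k`-th
coefficient of `a† x` is `√k x_{k-1}` (and `0` for `k = 0`). -/
def creat : H →ₗ.[ℂ] H where
  domain := ladderDomain φ
  toFun :=
    { toFun := fun x => φ.repr.symm ⟨_, memlp_creat φ x⟩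
      map_add' := by
        intro x y
        rw [← map_add]
        congr 1
        ext k
        simp [mul_add]
        rfl
      map_smul' := by
        intro c x
        rw [RingHom.id_apply, ← map_smul]
        congr 1
        ext k
        simp [mul_left_comm] }

/-- The operator `z a† - z̄ a`. -/
def dispGen (z : ℂ) : H →ₗ.[ℂ] H := z • creat φ - conj z • annih φ

/-- The displacement operator `D(z) = exp (z a† - z̄ a)`. -/
def disp (z : ℂ) : H →L[ℂ] H := opExp (dispGen φ z)

end Ladder

/-! ### Matrices acting on `ℂⁿ ⊗ H` -/

section Matrices

variable {H : Type*} [NormedAddCommGroup H] [InnerProductSpace ℂ H] {n : ℕ}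

/-- The matrix `M` as an operator on `ℂⁿ`. -/
abbrev matOp (M : Matrix (Fin n) (Fin n) ℂ) :
    EuclideanSpace ℂ (Fin n) →ₗ[ℂ] EuclideanSpace ℂ (Fin n) :=
  Matrix.toEuclideanLin M

/-- The operator `M ⊗ I` on `ℂⁿ ⊗ H`. -/
def matTensorId (H : Type*) [NormedAddCommGroup H] [InnerProductSpace ℂ H]
    (M : Matrix (Fin n) (Fin n) ℂ) :
    (EuclideanSpace ℂ (Fin n) ⊗[ℂ] H) →ₗ[ℂ] (EuclideanSpace ℂ (Fin n) ⊗[ℂ] H) :=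
  TensorProduct.map (matOp M) LinearMap.id

/-- The operator `diag(B₁, …, Bₙ) = ∑ⱼ |eⱼ⟩⟨eⱼ| ⊗ Bⱼ` on `ℂⁿ ⊗ H`. -/
def diagOp (B : Fin n → H →L[ℂ] H) :
    (EuclideanSpace ℂ (Fin n) ⊗[ℂ] H) →ₗ[ℂ] (EuclideanSpace ℂ (Fin n) ⊗[ℂ] H) :=
  ∑ j, TensorProduct.map (matOp (Matrix.single j j 1)) (B j : H →ₗ[ℂ] H)

/-- The operator `M ⊗ A` on `ℂⁿ ⊗ H` for a matrix `M` and an unbounded operator `A` on `H`. Its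
domain is `ℂⁿ ⊗ dom A`, as a subspace of `ℂⁿ ⊗ H`. -/
def matTensor (M : Matrix (Fin n) (Fin n) ℂ) (A : H →ₗ.[ℂ] H) :
    (EuclideanSpace ℂ (Fin n) ⊗[ℂ] H) →ₗ.[ℂ] (EuclideanSpace ℂ (Fin n) ⊗[ℂ] H) where
  domain := LinearMap.range (A.domain.subtype.lTensor (EuclideanSpace ℂ (Fin n)))
  toFun := TensorProduct.map (matOp M) A.toFun ∘ₗ
    (LinearEquiv.ofInjective (A.domain.subtype.lTensor (EuclideanSpace ℂ (Fin n)))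
      (Module.Flat.lTensor_preserves_injective_linearMap _ A.domain.injective_subtype)).symm

variable (φ : HilbertBasis ℕ ℂ H)

/-- The operator `Z ⊗ a† - Z* ⊗ a`. -/
def matDispGen (Z : Matrix (Fin n) (Fin n) ℂ) :
    (EuclideanSpace ℂ (Fin n) ⊗[ℂ] H) →ₗ.[ℂ] (EuclideanSpace ℂ (Fin n) ⊗[ℂ] H) :=
  matTensor Z (creat φ) - matTensor Zᴴ (annih φ)

/-- The matrix displacement operator `𝔻(Z) = exp (Z ⊗ a† - Z* ⊗ a)`. -/
def matDisp (Z : Matrix (Fin n) (Fin n) ℂ) :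
    (EuclideanSpace ℂ (Fin n) ⊗[ℂ] H) →L[ℂ] (EuclideanSpace ℂ (Fin n) ⊗[ℂ] H) :=
  opExp (matDispGen φ Z)

/-- The `k`-th term `(k!)^{-1/2} Z^k χ ⊗ φ_k` of the series defining the coherent states. -/
def vcsTerm (Z : Matrix (Fin n) (Fin n) ℂ) (χ : EuclideanSpace ℂ (Fin n)) (k : ℕ) :
    EuclideanSpace ℂ (Fin n) ⊗[ℂ] H :=
  ((Real.sqrt (k.factorial) : ℂ)⁻¹ • matOp (Z ^ k) χ) ⊗ₜ[ℂ] φ k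

/-- The canonical vector coherent state
`e^{-Tr|Z|²/2} ∑ₖ (k!)^{-1/2} Z^k χ ⊗ φ_k`, where `|Z|² = Z Z*`. -/
def vcs (Z : Matrix (Fin n) (Fin n) ℂ) (χ : EuclideanSpace ℂ (Fin n)) :
    EuclideanSpace ℂ (Fin n) ⊗[ℂ] H :=
  Complex.exp (-(1 / 2) * (Z * Zᴴ).trace) • ∑' k, vcsTerm φ Z χ k

/-- The number `z_j = r_j e^{iθ_j}`. -/
def polarC {n : ℕ} (r θ : Fin n → ℝ) (j : Fin n) : ℂ :=
  (r j : ℂ) * Complex.exp ((θ j : ℂ) * Complex.I)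

/-- The decomposition `Z = V diag(r₁ e^{iθ₁}, …, rₙ e^{iθₙ}) V*` of a normal matrix, with `V`
unitary, `r_j ≥ 0` and `0 ≤ θ_j < 2π`. -/
structure IsNormalDecomp {n : ℕ} (Z V : Matrix (Fin n) (Fin n) ℂ) (r θ : Fin n → ℝ) : Prop where
  unitary : V ∈ Matrix.unitaryGroup (Fin n) ℂ
  r_nonneg : ∀ j, 0 ≤ r j
  θ_mem : ∀ j, θ j ∈ Set.Ico 0 (2 * Real.pi)
  eq : Z = V * Matrix.diagonal (polarC r θ) * Vᴴ

/-- `T = diag(a₁, …, aₙ)` with `a_i = ∑ⱼ r_j² - r_i²`. -/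
def matT {n : ℕ} (r : Fin n → ℝ) : Matrix (Fin n) (Fin n) ℂ :=
  Matrix.diagonal fun i => (((∑ j, r j ^ 2) - r i ^ 2 : ℝ) : ℂ)

end Matrices

end VCS

end

/-!
For a single mode the displacement group is determined by its action on the unnormalised coherent
vectors `e(α) = ∑ₖ α^k / √k! φ_k`, namely
`D(tz) e(α) = exp (-|tz|²/2 - t z̄ α) e(α + tz)`. These vectors form a total set
(`span_expVec_dense`), and the formula preserves their Gram matrix `⟨e(α), e(β)⟩ = exp (ᾱ β)`
(`inner_expVec`), so it defines a strongly continuous unitary group. Since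
`a e(α) = α e(α)` and `a† e(α) = e'(α)`, its derivative at `t = 0` on `e(α)` is
`(z a† - z̄ a) e(α)`. It remains to identify the generator as the closure of `z a† - z̄ a` on the
full natural domain. The span of the coherent vectors is invariant, so `1 - A` has dense range on it
(a vector `w` orthogonal to the range makes `t ↦ ⟨w, T(t) d⟩` a bounded solution of `f' = f`), and
for skew-symmetric `A` one has `‖x - A x‖² = ‖x‖² + ‖A x‖²`. Hence every skew-symmetric extension
of `A` restricted to that span lies in its closure (`C0Group.isGeneratedBy_of_core`). Uniqueness of
the group also comes from skew-symmetry (`C0Group.eq_of_isGeneratedBy`).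

A normal `Z` has an orthonormal eigenbasis `b j` with eigenvalues `z j`. The vectors
`b j ⊗ e(α)` are total in `ℂⁿ ⊗ H`, and the same argument applies to `Z ⊗ a† - Z* ⊗ a` with the
flow `b j ⊗ e(α) ↦ b j ⊗ D(t z_j) e(α)` (`matDisp_spec`). This gives `𝔻(Z) = V diag(D(z_j)) V*`.
The formula for the coherent states follows by expanding `χ` in the eigenbasis, because
`D(z) φ_0 = exp (-|z|²/2) e(z)`, and the matrix `exp (-VTV*/2)` supplies the factor by which
`exp (-Tr|Z|²/2)` and `exp (-|z_j|²/2)` differ.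
-/

noncomputable section

namespace VCS

/-! ### Unitary groups with skew-symmetric generators -/

section Groups

variable {E : Type*} [NormedAddCommGroup E] [InnerProductSpace ℂ E]

open Filter Topology

/-- The chain rule for a complex-linear map along a real curve. The two pointwise hypotheses keep
the real structure on `E` abstract, so that the lemma applies to tensor products, where instance
search finds a real structure other than the restriction of scalars. -/
lemma hasDerivAt_of_clm {F : Type*} [NormedAddCommGroup F] [NormedSpace ℂ F] (L : F →L[ℂ] E)
    {f : ℝ → F} {f' : F} {g : ℝ → E} {g' : E} {t : ℝ} (hf : HasDerivAt f f' t)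
    (hg : ∀ s, g s = L (f s)) (hg' : g' = L f') : HasDerivAt g g' t := by
  rw [funext hg, hg']
  exact (L.restrictScalars ℝ).hasFDerivAt.comp_hasDerivAt t hf

lemma C0Group.hasDerivAt_op (T : C0Group E) {x y : E} (h : (x, y) ∈ T.generatorGraph) (t : ℝ) :
    HasDerivAt (fun s => T.op s x) (T.op t y) t := by
  have h0 : HasDerivAt (fun s : ℝ => T.op s x) y (t - t) := by
    rw [sub_self]; exact h
  have h1 : HasDerivAt (fun s : ℝ => T.op (s - t) x) y t := h0.comp_sub_const t t
  refine hasDerivAt_of_clm (T.op t) h1 (fun s => ?_) rfl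
  rw [← ContinuousLinearMap.comp_apply, ← T.op_add, add_sub_cancel]

lemma C0Group.op_mem_generatorGraph (T : C0Group E) {x y : E} (h : (x, y) ∈ T.generatorGraph)
    (t : ℝ) : (T.op t x, T.op t y) ∈ T.generatorGraph := by
  have h0 : HasDerivAt (fun s => T.op s x) (T.op t y) (0 + t) := by
    rw [zero_add]; exact T.hasDerivAt_op h t
  have h1 := h0.comp_add_const 0 t
  refine h1.congr_of_eventuallyEq (Eventually.of_forall fun s => ?_)
  change T.op s (T.op t x) = T.op (s + t) x
  rw [T.op_add, ContinuousLinearMap.comp_apply]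

/-- The generator of a group as a linear relation. -/
def C0Group.generatorSubmodule (T : C0Group E) : Submodule ℂ (E × E) where
  carrier := T.generatorGraph
  zero_mem' := by
    simpa [C0Group.generatorGraph] using hasDerivAt_const (0 : ℝ) (0 : E)
  add_mem' := by
    intro p q hp hq
    simpa [C0Group.generatorGraph] using HasDerivAt.fun_add hp hq
  smul_mem' := by
    intro c p hp
    simpa [C0Group.generatorGraph] using HasDerivAt.fun_const_smul c hp

/-- A set of pairs `(x, y)` with `Re ⟨y, x⟩ = 0`: the graph of a skew-symmetric relation. -/
def IsSkew (G : Set (E × E)) : Prop := ∀ p ∈ G, (inner ℂ p.2 p.1).re = 0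

lemma IsSkew.closure {G : Set (E × E)} (h : IsSkew G) : IsSkew (closure G) := by
  intro p hp
  have hc : IsClosed {p : E × E | (inner ℂ p.2 p.1).re = 0} :=
    isClosed_eq (Complex.continuous_re.comp (continuous_snd.inner continuous_fst))
      continuous_const
  exact closure_minimal h hc hp

lemma inner_add_inner_swap_eq_zero {x y : E} (h : (inner ℂ y x).re = 0) :
    inner ℂ x y + inner ℂ y x = 0 := by
  rw [← inner_conj_symm x y, add_comm, Complex.add_conj, h]
  simp

/-- Two orbits starting at the same point of the domain of a skew-symmetric generator have a
difference of constant norm, hence coincide. -/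
lemma C0Group.eq_of_isGeneratedBy {A : E →ₗ.[ℂ] E} (hA : IsSkew (A.graph : Set (E × E)))
    (hd : Dense (A.domain : Set E)) {T S : C0Group E} (hT : T.IsGeneratedBy A)
    (hS : S.IsGeneratedBy A) : T = S := by
  have key : ∀ x ∈ A.domain, ∀ t, T.op t x = S.op t x := by
    intro x hx t
    have hmem : (x, A ⟨x, hx⟩) ∈ closure (A.graph : Set (E × E)) :=
      subset_closure (A.mem_graph ⟨x, hx⟩)
    have hxT : (x, A ⟨x, hx⟩) ∈ T.generatorGraph := by rw [hT]; exact hmem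
    have hxS : (x, A ⟨x, hx⟩) ∈ S.generatorGraph := by rw [hS]; exact hmem
    have hg : ∀ s, HasDerivAt (fun s => T.op s x - S.op s x)
        (T.op s (A ⟨x, hx⟩) - S.op s (A ⟨x, hx⟩)) s := fun s =>
      (T.hasDerivAt_op hxT s).sub (S.hasDerivAt_op hxS s)
    have hin : ∀ s, HasDerivAt
        (fun s => inner ℂ (T.op s x - S.op s x) (T.op s x - S.op s x)) 0 s := by
      intro s
      have h := (hg s).inner ℂ (hg s)
      have hs : (T.op s x - S.op s x, T.op s (A ⟨x, hx⟩) - S.op s (A ⟨x, hx⟩)) ∈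
          closure (A.graph : Set (E × E)) := by
        have h1 : (T.op s x, T.op s (A ⟨x, hx⟩)) ∈ A.graph.topologicalClosure := by
          have := T.op_mem_generatorGraph hxT s
          rw [hT] at this; exact this
        have h2 : (S.op s x, S.op s (A ⟨x, hx⟩)) ∈ A.graph.topologicalClosure := by
          have := S.op_mem_generatorGraph hxS s
          rw [hS] at this; exact this
        exact A.graph.topologicalClosure.sub_mem h1 h2
      rwa [inner_add_inner_swap_eq_zero (hA.closure _ hs)] at h
    have hconst := is_const_of_deriv_eq_zero (fun s => (hin s).differentiableAt)
      (fun s => (hin s).deriv) t 0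
    simp only [T.op_zero, S.op_zero, ContinuousLinearMap.id_apply, sub_self, inner_zero_left,
      inner_self_eq_zero] at hconst
    exact sub_eq_zero.1 hconst
  ext t x
  exact congrFun (Continuous.ext_on hd (T.op t).continuous (S.op t).continuous
    fun y hy => key y hy t) x

/-- The derivative at `0` of the constant function `t ↦ ‖T(t) x‖²` vanishes. -/
lemma C0Group.isSkew_generatorGraph (T : C0Group E) (hT : ∀ t x, ‖T.op t x‖ = ‖x‖) :
    IsSkew T.generatorGraph := by
  intro p hp
  have hp' : HasDerivAt (fun t : ℝ => T.op t p.1) p.2 0 := hp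
  have h1 := hp'.inner ℂ hp'
  have h2 : (fun t => inner ℂ (T.op t p.1) (T.op t p.1)) = fun _ => inner ℂ p.1 p.1 := by
    funext t
    rw [inner_self_eq_norm_sq_to_K, inner_self_eq_norm_sq_to_K, hT]
  rw [h2] at h1
  have h3 := h1.unique (hasDerivAt_const _ _)
  rw [T.op_zero, ContinuousLinearMap.id_apply, ← inner_conj_symm p.1 p.2, add_comm,
    Complex.add_conj] at h3
  simpa using h3

/-- Orbits converge uniformly together with their derivatives, because the group is isometric. -/
lemma C0Group.isClosed_generatorGraph (T : C0Group E) (hT : ∀ t x, ‖T.op t x‖ = ‖x‖) :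
    IsClosed T.generatorGraph := by
  refine isClosed_of_closure_subset fun p hp => ?_
  obtain ⟨q, hq, hlim⟩ := mem_closure_iff_seq_limit.1 hp
  have h1 : Tendsto (fun n => (q n).1) atTop (𝓝 p.1) := (continuous_fst.tendsto _).comp hlim
  have h2 : Tendsto (fun n => (q n).2) atTop (𝓝 p.2) := (continuous_snd.tendsto _).comp hlim
  have hu : TendstoUniformly (fun n t => T.op t (q n).2) (fun t => T.op t p.2) atTop := by
    rw [Metric.tendstoUniformly_iff]
    intro ε hε
    filter_upwards [Metric.tendsto_nhds.1 h2 ε hε] with n hn t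
    rw [dist_comm, dist_eq_norm, ← map_sub, hT, ← dist_eq_norm]
    exact hn
  have h3 := hasDerivAt_of_tendstoUniformly hu
    (Eventually.of_forall fun n t => T.hasDerivAt_op (hq n) t)
    (fun t => ((T.op t).continuous.tendsto _).comp h1) 0
  rw [T.op_zero] at h3
  exact h3

/-- A skew-symmetric relation `G` lies in the closure of a subset `F` if the differences `x - y`,
`(x, y) ∈ F`, are dense: for skew-symmetric pairs, `‖x - y‖² = ‖x‖² + ‖y‖²`. -/
lemma IsSkew.le_closure_of_dense {G : Submodule ℂ (E × E)} (hG : IsSkew (G : Set (E × E)))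
    {F : Set (E × E)} (hFG : F ⊆ G) (hF : Dense ((fun p : E × E => p.1 - p.2) '' F)) :
    (G : Set (E × E)) ⊆ _root_.closure F := by
  intro p hp
  rw [Metric.mem_closure_iff]
  intro ε hε
  obtain ⟨_, hqε, q, hq, rfl⟩ := Metric.dense_iff.1 hF (p.1 - p.2) ε hε
  refine ⟨q, hq, ?_⟩
  have hs := hG _ (G.sub_mem hp (hFG hq))
  have hn : ‖(p - q).1 - (p - q).2‖ ^ 2 = ‖(p - q).1‖ ^ 2 + ‖(p - q).2‖ ^ 2 := by
    have h := @norm_sub_sq ℂ _ _ _ _ (p - q).1 (p - q).2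
    rw [← inner_conj_symm, RCLike.conj_re, show RCLike.re _ = (0 : ℝ) from hs] at h
    linarith
  have hlt : ‖(p - q).1 - (p - q).2‖ < ε := by
    rw [Metric.mem_ball, dist_comm, dist_eq_norm] at hqε
    have he : (p - q).1 - (p - q).2 = p.1 - p.2 - (q.1 - q.2) := by
      rw [Prod.fst_sub, Prod.snd_sub]
      abel
    rwa [he]
  have a1 : ‖(p - q).1‖ < ε := by
    nlinarith [norm_nonneg (p - q).1, norm_nonneg (p - q).2, norm_nonneg ((p - q).1 - (p - q).2)]
  have a2 : ‖(p - q).2‖ < ε := by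
    nlinarith [norm_nonneg (p - q).1, norm_nonneg (p - q).2, norm_nonneg ((p - q).1 - (p - q).2)]
  rw [dist_eq_norm, Prod.norm_def]
  exact max_lt a1 a2

/-- A bounded function that equals its own derivative vanishes. -/
lemma eq_zero_of_hasDerivAt_self_of_bounded {f : ℝ → ℂ} (hf : ∀ t, HasDerivAt f (f t) t) {C : ℝ}
    (hC : ∀ t, ‖f t‖ ≤ C) : f 0 = 0 := by
  have hd : ∀ t : ℝ, HasDerivAt (fun t : ℝ => Real.exp (-t) • f t) 0 t := by
    intro t
    have h1 : HasDerivAt (fun t : ℝ => Real.exp (-t)) (-Real.exp (-t)) t := by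
      simpa using (hasDerivAt_neg t).exp
    refine (h1.fun_smul (hf t)).congr_deriv ?_
    rw [neg_smul, add_neg_cancel]
  have hb : ∀ t : ℝ, ‖f 0‖ ≤ Real.exp (-t) * C := by
    intro t
    have hconst := is_const_of_deriv_eq_zero (fun s => (hd s).differentiableAt)
      (fun s => (hd s).deriv) 0 t
    simp only [neg_zero, Real.exp_zero, one_smul] at hconst
    rw [hconst, norm_smul, Real.norm_eq_abs, abs_of_pos (Real.exp_pos _)]
    exact mul_le_mul_of_nonneg_left (hC t) (Real.exp_pos _).le
  have hlim : Tendsto (fun t : ℝ => Real.exp (-t) * C) atTop (𝓝 (0 * C)) :=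
    (Real.tendsto_exp_neg_atTop_nhds_zero).mul_const C
  rw [zero_mul] at hlim
  exact norm_le_zero_iff.1 (ge_of_tendsto' hlim hb)

/-- A dense invariant subspace `K` of the domain, on which the operator `A` is the derivative of
the group, is a core: the generator is the closure of `A`. -/
lemma C0Group.isGeneratedBy_of_core [CompleteSpace E] (T : C0Group E)
    (hT : ∀ t x, ‖T.op t x‖ = ‖x‖) {A : E →ₗ.[ℂ] E} (hA : IsSkew (A.graph : Set (E × E)))
    {K : Submodule ℂ E} (hK : K.topologicalClosure = ⊤) (hinv : ∀ t, ∀ x ∈ K, T.op t x ∈ K)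
    (hKA : ∀ x ∈ K, ∃ y, (x, y) ∈ A.graph ∧ (x, y) ∈ T.generatorGraph) :
    T.IsGeneratedBy A := by
  -- `F` is contained in both graphs, so it suffices that `x - y`, for `(x, y) ∈ F`, is dense.
  set F : Submodule ℂ (E × E) := A.graph ⊓ T.generatorSubmodule with hFdef
  have hF : Dense ((fun p : E × E => p.1 - p.2) '' F) := by
    set R : Submodule ℂ E :=
      F.map (LinearMap.fst ℂ E E - LinearMap.snd ℂ E E) with hR
    have hRF : (R : Set E) = (fun p : E × E => p.1 - p.2) '' F := by
      ext; simp [hR]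
    rw [← hRF, Submodule.dense_iff_topologicalClosure_eq_top, R.topologicalClosure_eq_top_iff,
      Submodule.eq_bot_iff]
    intro w hw
    have hwK : ∀ x ∈ K, inner ℂ w x = 0 := by
      intro x hx
      obtain ⟨y, -, hxy⟩ := hKA x hx
      have h := eq_zero_of_hasDerivAt_self_of_bounded
        (f := fun t => inner ℂ w (T.op t x)) (C := ‖w‖ * ‖x‖) (fun t => ?_) (fun t => ?_)
      · simpa [T.op_zero] using h
      · -- `A` commutes with the group on `K`, and `w ⊥ (1 - A) T(t) x`.
        have h1 := (hasDerivAt_const t w).inner ℂ (T.hasDerivAt_op hxy t)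
        rw [inner_zero_left, add_zero] at h1
        obtain ⟨y', hy1, hy2⟩ := hKA _ (hinv t x hx)
        have hyy : y' = T.op t y :=
          HasDerivAt.unique hy2 (T.op_mem_generatorGraph hxy t)
        have h2 : inner ℂ w (T.op t x - y') = 0 :=
          (Submodule.mem_orthogonal' R w).1 hw _ ⟨(T.op t x, y'), ⟨hy1, hy2⟩, by simp⟩
        rw [inner_sub_right, sub_eq_zero] at h2
        rw [h2, hyy]
        exact h1
      · exact (norm_inner_le_norm w (T.op t x)).trans_eq (by rw [hT])
    have hKo : w ∈ Kᗮ := (Submodule.mem_orthogonal' K w).2 hwK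
    rwa [K.topologicalClosure_eq_top_iff.1 hK, Submodule.mem_bot] at hKo
  apply Set.Subset.antisymm
  · -- the generator is skew-symmetric and extends `F`
    refine (IsSkew.le_closure_of_dense (G := T.generatorSubmodule) (T.isSkew_generatorGraph hT)
      (fun p hp => hp.2) hF).trans (closure_mono fun p hp => hp.1)
  · refine closure_minimal ?_ (T.isClosed_generatorGraph hT)
    -- the graph of `A` is skew-symmetric and extends `F`
    refine (IsSkew.le_closure_of_dense hA (fun p hp => hp.1) hF).trans ?_
    exact closure_minimal (fun p hp => hp.2) (T.isClosed_generatorGraph hT)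

lemma norm_eq_of_inner_self_eq {F : Type*} [NormedAddCommGroup F] [InnerProductSpace ℂ F]
    {x : E} {y : F} (h : inner ℂ x x = inner ℂ y y) : ‖x‖ = ‖y‖ := by
  rw [inner_self_eq_norm_sq_to_K, inner_self_eq_norm_sq_to_K] at h
  have h2 : ‖x‖ ^ 2 = ‖y‖ ^ 2 := by exact_mod_cast h
  exact (sq_eq_sq₀ (norm_nonneg _) (norm_nonneg _)).1 h2

/-- Two families with the same Gram matrix, the first of them total, are related by an isometry. -/
lemma exists_isometry_of_inner_eq [CompleteSpace E] {ι : Type*} {u v : ι → E}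
    (hu : (Submodule.span ℂ (Set.range u)).topologicalClosure = ⊤)
    (huv : ∀ i j, inner ℂ (v i) (v j) = inner ℂ (u i) (u j)) :
    ∃ L : E →L[ℂ] E, (∀ x, ‖L x‖ = ‖x‖) ∧ ∀ i, L (u i) = v i := by
  set e := Finsupp.linearCombination ℂ u
  set f := Finsupp.linearCombination ℂ v
  have hn : ∀ c, ‖f c‖ = ‖e c‖ := by
    intro c
    apply norm_eq_of_inner_self_eq
    simp only [e, f, Finsupp.linearCombination_apply, Finsupp.sum_inner, Finsupp.inner_sum,
      inner_smul_left, inner_smul_right, huv]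
  have hd : DenseRange e := by
    have : Set.range e = (Submodule.span ℂ (Set.range u) : Set E) := by
      rw [← Finsupp.range_linearCombination]; rfl
    rw [DenseRange, this]
    exact Submodule.dense_iff_topologicalClosure_eq_top.2 hu
  have hex : ∃ C : ℝ, ∀ c, ‖f c‖ ≤ C * ‖e c‖ := ⟨1, fun c => by rw [hn, one_mul]⟩
  have heq : ∀ c, f.extendOfNorm e (e c) = f c := LinearMap.extendOfNorm_eq hd hex
  refine ⟨f.extendOfNorm e, fun x => ?_, fun i => ?_⟩
  · refine congrFun (Continuous.ext_on hd (f := fun x => ‖f.extendOfNorm e x‖)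
      (g := fun x => ‖x‖) (f.extendOfNorm e).continuous.norm continuous_norm ?_) x
    rintro _ ⟨c, rfl⟩
    simp only [heq, hn]
  · simpa [e, f] using heq (Finsupp.single i 1)

/-- A multiplicative cocycle `c` over a flow `σ` on the index set of a total family `u`, such that
`u i ↦ c t i • u (σ t i)` preserves inner products, defines a unitary group. -/
lemma exists_c0Group_of_flow [CompleteSpace E] {ι : Type*} {u : ι → E}
    (hu : (Submodule.span ℂ (Set.range u)).topologicalClosure = ⊤)
    {c : ℝ → ι → ℂ} {σ : ℝ → ι → ι}
    (hin : ∀ t i j, inner ℂ (c t i • u (σ t i)) (c t j • u (σ t j)) = inner ℂ (u i) (u j))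
    (hc0 : ∀ i, c 0 i = 1) (hσ0 : ∀ i, σ 0 i = i)
    (hc : ∀ s t i, c (s + t) i = c t i * c s (σ t i))
    (hσ : ∀ s t i, σ (s + t) i = σ s (σ t i))
    (hcont : ∀ i, Continuous fun t => c t i • u (σ t i)) :
    ∃ T : C0Group E, (∀ t x, ‖T.op t x‖ = ‖x‖) ∧ ∀ t i, T.op t (u i) = c t i • u (σ t i) := by
  choose L hL hLu using fun t => exists_isometry_of_inner_eq hu (hin t)
  have hd : Dense (Submodule.span ℂ (Set.range u) : Set E) :=
    Submodule.dense_iff_topologicalClosure_eq_top.2 hu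
  have hext : ∀ P Q : E →L[ℂ] E, (∀ i, P (u i) = Q (u i)) → P = Q := by
    intro P Q h
    refine ContinuousLinearMap.ext_on hd ?_
    rintro _ ⟨i, rfl⟩
    exact h i
  refine ⟨⟨L, hext _ _ fun i => ?_, fun s t => hext _ _ fun i => ?_, fun x => ?_⟩, hL, hLu⟩
  · simp [hLu, hc0, hσ0]
  · simp [hLu, hc, hσ, mul_smul]
  · have hspan : ∀ x ∈ Submodule.span ℂ (Set.range u), Continuous fun t => L t x := by
      intro x hx
      induction hx using Submodule.span_induction with
      | mem x hx => obtain ⟨i, rfl⟩ := hx; simpa only [hLu] using hcont i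
      | zero => simpa using continuous_const
      | add x y _ _ hx hy => simpa only [map_add] using hx.fun_add hy
      | smul a x _ hx => simpa only [map_smul] using hx.fun_const_smul a
    refine continuous_of_uniform_approx_of_continuous fun V hV => ?_
    obtain ⟨ε, hε, hεV⟩ := Metric.mem_uniformity_dist.1 hV
    obtain ⟨y, hy, hyd⟩ := Metric.dense_iff.1 hd x ε hε
    refine ⟨fun t => L t y, hspan y hyd, fun t => hεV ?_⟩
    rw [dist_eq_norm, ← map_sub, hL, ← dist_eq_norm, dist_comm]
    exact hy

lemma C0Group.exists_isometryEquiv [CompleteSpace E] (T : C0Group E)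
    (hT : ∀ t x, ‖T.op t x‖ = ‖x‖) (t : ℝ) : ∃ U : E ≃ₗᵢ[ℂ] E, ∀ x, T.op t x = U x := by
  have h : ∀ s x, T.op s (T.op (-s) x) = x := fun s x => by
    rw [← ContinuousLinearMap.comp_apply, ← T.op_add, add_neg_cancel, T.op_zero]
    rfl
  exact ⟨LinearIsometryEquiv.ofSurjective ⟨(T.op t : E →ₗ[ℂ] E), hT t⟩
    (fun x => ⟨T.op (-t) x, h t x⟩), fun x => rfl⟩

/-- A skew-symmetric operator that is, on a total family `u` in its domain, the infinitesimal
generator of a unitary flow `u i ↦ c t i • u (σ t i)`, generates a unique group, and this group is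
unitary and extends the flow. -/
theorem exists_isGeneratedBy_of_flow [CompleteSpace E] {A : E →ₗ.[ℂ] E}
    (hA : IsSkew (A.graph : Set (E × E))) {ι : Type*} {u : ι → E}
    (hu : (Submodule.span ℂ (Set.range u)).topologicalClosure = ⊤)
    {c : ℝ → ι → ℂ} {σ : ℝ → ι → ι}
    (hin : ∀ t i j, inner ℂ (c t i • u (σ t i)) (c t j • u (σ t j)) = inner ℂ (u i) (u j))
    (hc0 : ∀ i, c 0 i = 1) (hσ0 : ∀ i, σ 0 i = i)
    (hc : ∀ s t i, c (s + t) i = c t i * c s (σ t i))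
    (hσ : ∀ s t i, σ (s + t) i = σ s (σ t i))
    (hcont : ∀ i, Continuous fun t => c t i • u (σ t i))
    (hder : ∀ i, ∃ y, (u i, y) ∈ A.graph ∧ HasDerivAt (fun t : ℝ => c t i • u (σ t i)) y 0) :
    (∃! T : C0Group E, T.IsGeneratedBy A) ∧
      (∃ U : E ≃ₗᵢ[ℂ] E, ∀ x, opExp A x = U x) ∧
      ∀ i, opExp A (u i) = c 1 i • u (σ 1 i) := by
  obtain ⟨T, hT, hTu⟩ := exists_c0Group_of_flow hu hin hc0 hσ0 hc hσ hcont
  have hfst : ∀ x ∈ Submodule.span ℂ (Set.range u),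
      ∃ y, (x, y) ∈ A.graph ∧ (x, y) ∈ T.generatorGraph := by
    intro x hx
    have hle : Submodule.span ℂ (Set.range u) ≤
        (A.graph ⊓ T.generatorSubmodule).map (LinearMap.fst ℂ E E) := by
      rw [Submodule.span_le]
      rintro _ ⟨i, rfl⟩
      obtain ⟨y, hy, hy'⟩ := hder i
      refine ⟨(u i, y), ⟨hy, ?_⟩, rfl⟩
      change HasDerivAt (fun t : ℝ => T.op t (u i)) y 0
      simpa only [hTu] using hy'
    obtain ⟨⟨x', y⟩, ⟨h1, h2⟩, rfl⟩ := hle hx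
    exact ⟨y, h1, h2⟩
  have hgen : T.IsGeneratedBy A := by
    refine T.isGeneratedBy_of_core hT hA hu (fun t x hx => ?_) hfst
    induction hx using Submodule.span_induction with
    | mem x hx =>
      obtain ⟨i, rfl⟩ := hx
      rw [hTu]
      exact Submodule.smul_mem _ _ (Submodule.subset_span ⟨_, rfl⟩)
    | zero => simp
    | add x y _ _ hx hy => rw [map_add]; exact Submodule.add_mem _ hx hy
    | smul a x _ hx => rw [map_smul]; exact Submodule.smul_mem _ _ hx
  have hdom : Dense (A.domain : Set E) := by
    refine (Submodule.dense_iff_topologicalClosure_eq_top.2 hu).mono fun x hx => ?_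
    obtain ⟨y, hy, -⟩ := hfst x hx
    exact LinearPMap.mem_domain_of_mem_graph hy
  have hex : ∃! T : C0Group E, T.IsGeneratedBy A :=
    ⟨T, hgen, fun S hS => C0Group.eq_of_isGeneratedBy hA hdom hS hgen⟩
  have hop : opExp A = T.op 1 := by
    rw [opExp, dif_pos hex]
    congr 1
    exact C0Group.eq_of_isGeneratedBy hA hdom hex.choose_spec.1 hgen
  refine ⟨hex, ?_, fun i => by rw [hop, hTu]⟩
  rw [hop]
  exact T.exists_isometryEquiv hT 1

end Groups

/-! ### Coherent vectors and the displacement operators of one mode -/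

section CoherentVectors

variable {H : Type*} [NormedAddCommGroup H] [InnerProductSpace ℂ H]
variable (φ : HilbertBasis ℕ ℂ H)

open Filter Topology

lemma repr_of_hasSum {c : ℕ → ℂ} {x : H} (h : HasSum (fun k => c k • φ k) x) (k : ℕ) :
    φ.repr x k = c k := by
  rw [φ.repr_apply_apply]
  have h' : HasSum (fun i => inner ℂ (φ k) (c i • φ i)) (inner ℂ (φ k) x) :=
    (innerSL ℂ (φ k)).hasSum h
  have he : (fun i => inner ℂ (φ k) (c i • φ i)) = fun i => if i = k then c k else 0 := by
    funext i
    rw [inner_smul_right, orthonormal_iff_ite.1 φ.orthonormal]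
    by_cases hik : i = k
    · simp [hik]
    · simp [hik, Ne.symm hik]
  rw [he] at h'
  exact h'.unique (hasSum_ite_eq k (c k))

lemma inner_basis_right (x : H) (k : ℕ) : inner ℂ x (φ k) = conj (φ.repr x k) := by
  rw [φ.repr_apply_apply, inner_conj_symm]

lemma repr_creat (x : (creat φ).domain) (k : ℕ) :
    φ.repr (creat φ x) k = Real.sqrt k * φ.repr (x : H) (k - 1) := by
  change φ.repr (φ.repr.symm _) k = _
  rw [LinearIsometryEquiv.apply_symm_apply]

lemma repr_annih (x : (annih φ).domain) (k : ℕ) :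
    φ.repr (annih φ x) k = Real.sqrt (k + 1) * φ.repr (x : H) (k + 1) := by
  change φ.repr (φ.repr.symm _) k = _
  rw [LinearIsometryEquiv.apply_symm_apply]

/-- The creation and annihilation operators are formal adjoints: shift the summation index. -/
lemma inner_creat (x : (creat φ).domain) (y : (annih φ).domain) :
    inner ℂ (creat φ x) (y : H) = inner ℂ (x : H) (annih φ y) := by
  have h1 := (hasSum_nat_add_iff' 1).2 (φ.hasSum_inner_mul_inner (creat φ x) (y : H))
  have h2 := φ.hasSum_inner_mul_inner (x : H) (annih φ y)
  simp only [inner_basis_right, ← φ.repr_apply_apply, repr_creat, repr_annih] at h1 h2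
  simp only [Finset.range_one, Finset.sum_singleton, Nat.cast_zero, Real.sqrt_zero,
    Complex.ofReal_zero, zero_mul, map_zero, sub_zero] at h1
  refine h1.unique (h2.congr_fun fun k => ?_)
  simp only [map_mul, Complex.conj_ofReal, Nat.add_sub_cancel, Nat.cast_add, Nat.cast_one]
  ring

lemma isSkew_dispGen (z : ℂ) : IsSkew ((dispGen φ z).graph : Set (H × H)) := by
  rintro ⟨x, y⟩ hp
  obtain ⟨⟨x', hx, hx'⟩, rfl, rfl⟩ := (LinearPMap.mem_graph_iff _).1 hp
  have hm : x' ∈ ladderDomain φ := hx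
  change (inner ℂ (z • creat φ ⟨x', hm⟩ - conj z • annih φ ⟨x', hm⟩) x').re = 0
  have e : inner ℂ (annih φ ⟨x', hm⟩) x' = conj (inner ℂ (creat φ ⟨x', hm⟩) x') := by
    rw [inner_creat φ ⟨x', hm⟩ ⟨x', hm⟩, inner_conj_symm]
  rw [inner_sub_left, inner_smul_left, inner_smul_left, Complex.conj_conj, e]
  simp only [Complex.sub_re, Complex.mul_re, Complex.conj_re, Complex.conj_im]
  ring

/-- The arithmetic-geometric mean inequality compares the series with
`∑ (2 R²)^k / k!` and `∑ 2^{-k}`. -/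
lemma summable_pow_div_sqrt_factorial (R : ℝ) :
    Summable fun k : ℕ => (Real.sqrt k.factorial)⁻¹ * R ^ k := by
  have h1 : Summable fun k : ℕ => (2 * R ^ 2) ^ k / (k.factorial : ℝ) :=
    Real.summable_pow_div_factorial _
  have h2 : Summable fun k : ℕ => (1 / 2 : ℝ) ^ k :=
    summable_geometric_of_lt_one (by norm_num) (by norm_num)
  refine Summable.of_norm_bounded (h1.add h2) fun k => ?_
  have hf : (0 : ℝ) < k.factorial := by exact_mod_cast k.factorial_pos
  have hs : 0 < Real.sqrt k.factorial := Real.sqrt_pos.2 hf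
  have e1 : (2 * R ^ 2) ^ k / (k.factorial : ℝ) =
      2 ^ k * ((Real.sqrt k.factorial)⁻¹ * |R| ^ k) ^ 2 := by
    rw [mul_pow, mul_pow, inv_pow, Real.sq_sqrt hf.le, ← sq_abs R]
    ring
  have e2 : (1 / 2 : ℝ) ^ k = (2 ^ k)⁻¹ := by rw [one_div, inv_pow]
  rw [Real.norm_eq_abs, abs_mul, abs_pow, abs_of_pos (inv_pos.2 hs), e1, e2]
  set a := (Real.sqrt k.factorial)⁻¹ * |R| ^ k
  have hp : (0 : ℝ) < 2 ^ k := by positivity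
  have : 2 ^ k * a ^ 2 + (2 ^ k)⁻¹ - 2 * a = (2 ^ k)⁻¹ * (2 ^ k * a - 1) ^ 2 := by
    field_simp
    ring
  have ha : 0 ≤ a := by positivity
  nlinarith [show 0 ≤ (2 ^ k)⁻¹ * (2 ^ k * a - 1) ^ 2 by positivity]

/-- The `k`-th coefficient `α^k / √k!` of the unnormalised coherent vector. -/
def expCoeff (α : ℂ) (k : ℕ) : ℂ := (Real.sqrt k.factorial : ℂ)⁻¹ * α ^ k

/-- The unnormalised coherent (exponential) vector `∑ₖ α^k / √k! φ_k`. -/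
def expVec (α : ℂ) : H := ∑' k, expCoeff α k • φ k

lemma norm_expCoeff (α : ℂ) (k : ℕ) :
    ‖expCoeff α k‖ = (Real.sqrt k.factorial)⁻¹ * ‖α‖ ^ k := by
  rw [expCoeff, norm_mul, norm_inv, norm_pow, Complex.norm_real, Real.norm_eq_abs,
    abs_of_nonneg (Real.sqrt_nonneg _)]

section

variable [CompleteSpace H]

lemma hasSum_expVec (α : ℂ) : HasSum (fun k => expCoeff α k • φ k) (expVec φ α) := by
  refine (Summable.of_norm ?_).hasSum
  refine (summable_pow_div_sqrt_factorial ‖α‖).congr fun k => ?_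
  rw [norm_smul, φ.orthonormal.1, mul_one, norm_expCoeff]

lemma repr_expVec (α : ℂ) (k : ℕ) : φ.repr (expVec φ α) k = expCoeff α k :=
  repr_of_hasSum φ (hasSum_expVec φ α) k

lemma expVec_zero : expVec φ 0 = φ 0 := by
  refine (hasSum_expVec φ 0).unique ?_
  convert hasSum_ite_eq 0 (φ 0) using 2 with k
  by_cases hk : k = 0
  · simp [hk, expCoeff]
  · simp [hk, expCoeff]

lemma expCoeff_conj_mul (α β : ℂ) (k : ℕ) :
    conj (expCoeff α k) * expCoeff β k = (conj α * β) ^ k / (k.factorial : ℂ) := by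
  have hs : (Real.sqrt k.factorial : ℂ) * (Real.sqrt k.factorial : ℂ) = (k.factorial : ℂ) := by
    rw [← Complex.ofReal_mul, Real.mul_self_sqrt (Nat.cast_nonneg _), Complex.ofReal_natCast]
  rw [expCoeff, expCoeff, map_mul, map_inv₀, Complex.conj_ofReal, map_pow, ← hs, mul_pow,
    div_eq_mul_inv, mul_inv]
  ring

lemma inner_expVec (α β : ℂ) :
    inner ℂ (expVec φ α) (expVec φ β) = Complex.exp (conj α * β) := by
  have h := φ.hasSum_inner_mul_inner (expVec φ α) (expVec φ β)
  simp only [inner_basis_right, ← φ.repr_apply_apply, repr_expVec, expCoeff_conj_mul] at h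
  rw [Complex.exp_eq_exp_ℂ]
  exact h.unique (NormedSpace.expSeries_div_hasSum_exp _)

lemma sqrt_succ_mul_expCoeff_succ (α : ℂ) (k : ℕ) :
    (Real.sqrt (k + 1) : ℂ) * expCoeff α (k + 1) = α * expCoeff α k := by
  have hk : Real.sqrt ((k : ℝ) + 1) ≠ 0 := (Real.sqrt_pos.2 (by positivity)).ne'
  have hk' : (Real.sqrt ((k : ℝ) + 1) : ℂ) ≠ 0 := by exact_mod_cast hk
  rw [expCoeff, expCoeff, Nat.factorial_succ, Nat.cast_mul, Real.sqrt_mul (Nat.cast_nonneg _),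
    Nat.cast_add, Nat.cast_one, Complex.ofReal_mul, mul_inv]
  field_simp
  ring

lemma expVec_mem_ladderDomain (α : ℂ) : expVec φ α ∈ ladderDomain φ := by
  change Summable fun k : ℕ => (k : ℝ) * ‖φ.repr (expVec φ α) k‖ ^ 2
  refine (summable_nat_add_iff 1).1 ?_
  refine ((Real.summable_pow_div_factorial (‖α‖ ^ 2)).mul_left (‖α‖ ^ 2)).congr fun k => ?_
  have h := congrArg (fun w : ℂ => ‖w‖ ^ 2) (sqrt_succ_mul_expCoeff_succ α k)
  simp only [norm_mul, mul_pow, Complex.norm_real, Real.norm_eq_abs, sq_abs] at h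
  rw [Real.sq_sqrt (by positivity)] at h
  rw [repr_expVec, Nat.cast_add, Nat.cast_one, h, norm_expCoeff, mul_pow, inv_pow,
    Real.sq_sqrt (Nat.cast_nonneg _)]
  ring

/-- Coherent vectors are the eigenvectors of the annihilation operator. -/
lemma annih_expVec (α : ℂ) :
    annih φ ⟨expVec φ α, expVec_mem_ladderDomain φ α⟩ = α • expVec φ α := by
  apply φ.repr.injective
  ext k
  rw [repr_annih, repr_expVec, sqrt_succ_mul_expCoeff_succ, map_smul, lp.coeFn_smul,
    Pi.smul_apply, repr_expVec, smul_eq_mul]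

/-- On coherent vectors the creation operator is differentiation in the parameter. -/
lemma hasDerivAt_expVec (α : ℂ) :
    HasDerivAt (expVec φ) (creat φ ⟨expVec φ α, expVec_mem_ladderDomain φ α⟩) α := by
  set R : ℝ := ‖α‖ + 1 with hR
  have hR1 : 1 ≤ R := by linarith [norm_nonneg α]
  have hα : α ∈ Metric.ball (0 : ℂ) R := by simp [hR]
  have h := hasDerivAt_tsum_of_isPreconnected
    (g := fun k y => expCoeff y k • φ k)
    (g' := fun k y => ((Real.sqrt k.factorial : ℂ)⁻¹ * (k * y ^ (k - 1))) • φ k)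
    (summable_pow_div_sqrt_factorial (2 * R)) (Metric.isOpen_ball (x := (0 : ℂ)) (ε := R))
    (convex_ball _ _).isPreconnected (fun k y _ => ?_) (fun k y hy => ?_) hα
    (hasSum_expVec φ α).summable hα
  · refine h.congr_deriv (Eq.symm ?_)
    refine (φ.hasSum_repr _).tsum_eq.symm.trans (tsum_congr fun k => ?_)
    congr 1
    rw [repr_creat, repr_expVec]
    rcases k with _ | k
    · simp
    · have hk : Real.sqrt ((k : ℝ) + 1) ≠ 0 := (Real.sqrt_pos.2 (by positivity)).ne'
      have hk' : (Real.sqrt ((k : ℝ) + 1) : ℂ) ≠ 0 := by exact_mod_cast hk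
      have hs : ((k + 1 : ℕ) : ℂ) =
          (Real.sqrt ((k : ℝ) + 1) : ℂ) * (Real.sqrt ((k : ℝ) + 1) : ℂ) := by
        rw [← Complex.ofReal_mul, Real.mul_self_sqrt (by positivity)]
        push_cast
        rfl
      rw [hs, expCoeff, Nat.factorial_succ, Nat.cast_mul, Real.sqrt_mul (Nat.cast_nonneg _),
        Nat.cast_add, Nat.cast_one, Complex.ofReal_mul, mul_inv, Nat.add_sub_cancel]
      field_simp
  · exact ((hasDerivAt_pow k y).const_mul _).smul_const _
  · have hy' : ‖y‖ ≤ R := by simpa using (Metric.mem_ball.1 hy).le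
    rw [norm_smul, φ.orthonormal.1, mul_one, norm_mul, norm_inv, Complex.norm_real,
      Real.norm_eq_abs, abs_of_nonneg (Real.sqrt_nonneg _), norm_mul, norm_pow,
      Complex.norm_natCast, mul_pow]
    -- `k ≤ 2^k` and `R ≥ 1` reduce the bound to the series at `2R`
    have hk2 : (k : ℝ) ≤ 2 ^ k := by exact_mod_cast k.lt_two_pow_self.le
    have hpow : ‖y‖ ^ (k - 1) ≤ R ^ k :=
      (pow_le_pow_left₀ (norm_nonneg _) hy' _).trans (pow_le_pow_right₀ hR1 (Nat.sub_le _ _))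
    gcongr

/-- A vector orthogonal to all coherent vectors has a vanishing power series. -/
lemma span_expVec_dense :
    (Submodule.span ℂ (Set.range (expVec φ))).topologicalClosure = ⊤ := by
  rw [Submodule.topologicalClosure_eq_top_iff, Submodule.eq_bot_iff]
  intro w hw
  set c : ℕ → ℂ := fun k => (Real.sqrt k.factorial : ℂ)⁻¹ * inner ℂ w (φ k) with hc
  have hps : HasFPowerSeriesAt (0 : ℂ → ℂ) (FormalMultilinearSeries.ofScalars ℂ c) 0 := by
    refine hasFPowerSeriesAt_iff.2 (Eventually.of_forall fun α => ?_)
    have h0 : inner ℂ w (expVec φ α) = 0 :=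
      (Submodule.mem_orthogonal' _ w).1 hw _ (Submodule.subset_span ⟨α, rfl⟩)
    have h : HasSum (fun k => inner ℂ w (expCoeff α k • φ k)) (inner ℂ w (expVec φ α)) :=
      (innerSL ℂ w).hasSum (hasSum_expVec φ α)
    rw [h0] at h
    refine h.congr_fun fun k => ?_
    simp only [FormalMultilinearSeries.coeff_ofScalars, hc, expCoeff, smul_eq_mul,
      inner_smul_right]
    ring
  have hz : ∀ k, inner ℂ w (φ k) = 0 := by
    intro k
    have h := congrArg (fun p => FormalMultilinearSeries.coeff p k) hps.eq_zero
    simp only [FormalMultilinearSeries.coeff_ofScalars, hc] at h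
    have hs : (Real.sqrt k.factorial : ℂ)⁻¹ ≠ 0 := by
      have : Real.sqrt k.factorial ≠ 0 :=
        (Real.sqrt_pos.2 (by exact_mod_cast k.factorial_pos)).ne'
      exact inv_ne_zero (by exact_mod_cast this)
    exact (mul_eq_zero.1 (h.trans (by simp [FormalMultilinearSeries.coeff]))).resolve_left hs
  apply φ.repr.injective
  ext k
  rw [φ.repr_apply_apply, ← inner_conj_symm, hz]
  simp

end

/-- The factor `exp (- |tz|²/2 - t z̄ α)` in the action `D(tz) e(α) = c · e(α + tz)` of the
displacement operators on coherent vectors. -/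
def dispFactor (z : ℂ) (t : ℝ) (α : ℂ) : ℂ :=
  Complex.exp (-(1 / 2) * (t ^ 2 * (z * conj z)) - t * conj z * α)

lemma dispFactor_zero (z α : ℂ) : dispFactor z 0 α = 1 := by simp [dispFactor]

/-- The cocycle identity that makes `t ↦ D(tz)` a group. -/
lemma dispFactor_add (z : ℂ) (s t : ℝ) (α : ℂ) :
    dispFactor z (s + t) α = dispFactor z t α * dispFactor z s (α + t * z) := by
  rw [dispFactor, dispFactor, dispFactor, ← Complex.exp_add]
  congr 1
  push_cast
  ring

variable [CompleteSpace H]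

lemma inner_dispFactor_smul_expVec (z : ℂ) (t : ℝ) (α β : ℂ) :
    inner ℂ (dispFactor z t α • expVec φ (α + t * z)) (dispFactor z t β • expVec φ (β + t * z)) =
      inner ℂ (expVec φ α) (expVec φ β) := by
  rw [inner_smul_left, inner_smul_right, inner_expVec, inner_expVec, dispFactor, dispFactor,
    ← Complex.exp_conj, ← Complex.exp_add, ← Complex.exp_add]
  congr 1
  simp only [map_sub, map_mul, map_neg, map_add, map_pow, Complex.conj_ofReal, Complex.conj_conj,
    map_div₀, map_one, map_ofNat]
  ring

/-- At `t = 0` the derivative is `(z a† - z̄ a) e(α)`. -/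
lemma hasDerivAt_dispFactor_smul_expVec (z : ℂ) (t : ℝ) (α : ℂ) :
    HasDerivAt (fun t : ℝ => dispFactor z t α • expVec φ (α + t * z))
      (dispFactor z t α • z •
          creat φ ⟨expVec φ (α + t * z), expVec_mem_ladderDomain φ (α + t * z)⟩ -
        (dispFactor z t α * (t * (z * conj z) + conj z * α)) • expVec φ (α + t * z)) t := by
  have hid : HasDerivAt (fun t : ℝ => (t : ℂ)) 1 t := Complex.ofRealCLM.hasDerivAt
  have h1 : HasDerivAt (fun t : ℝ => dispFactor z t α)
      (dispFactor z t α * -(t * (z * conj z) + conj z * α)) t := by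
    have := ((((hid.fun_pow 2).mul_const (z * conj z)).const_mul (-(1 / 2))).fun_sub
      ((hid.mul_const (conj z)).mul_const α)).cexp
    refine this.congr_deriv ?_
    rw [dispFactor]
    congr 1
    simp
    ring
  have h2 : HasDerivAt (fun t : ℝ => expVec φ (α + t * z))
      (z • creat φ ⟨expVec φ (α + t * z), expVec_mem_ladderDomain φ (α + t * z)⟩) t := by
    have h3 : HasDerivAt (fun t : ℝ => α + t * z) z t := by
      simpa using (hid.mul_const z).const_add α
    exact (hasDerivAt_expVec φ (α + t * z)).scomp t h3
  refine (h1.fun_smul h2).congr_deriv ?_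
  rw [mul_neg, neg_smul, ← sub_eq_add_neg]

lemma continuous_dispFactor_smul_expVec (z α : ℂ) :
    Continuous fun t : ℝ => dispFactor z t α • expVec φ (α + t * z) :=
  continuous_iff_continuousAt.2 fun t =>
    (hasDerivAt_dispFactor_smul_expVec φ z t α).continuousAt

/-- The value of `z a† - z̄ a` at `e(α)`, with `a e(α) = α e(α)` inserted. -/
lemma dispGen_expVec (z α : ℂ) : (expVec φ α,
    z • creat φ ⟨expVec φ α, expVec_mem_ladderDomain φ α⟩ - (conj z * α) • expVec φ α) ∈
      (dispGen φ z).graph := by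
  have hm := expVec_mem_ladderDomain φ α
  refine (LinearPMap.mem_graph_iff _).2 ⟨⟨expVec φ α, hm, hm⟩, rfl, ?_⟩
  change z • creat φ ⟨expVec φ α, hm⟩ - conj z • annih φ ⟨expVec φ α, hm⟩ = _
  rw [annih_expVec, smul_smul]

/-- The group generated by `z a† - z̄ a` exists and is unique, and its value at time `1` displaces
coherent vectors by `z`. -/
theorem disp_spec (z : ℂ) :
    (∃! T : C0Group H, T.IsGeneratedBy (dispGen φ z)) ∧
      ∀ α, disp φ z (expVec φ α) = dispFactor z 1 α • expVec φ (α + z) := by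
  have h := exists_isGeneratedBy_of_flow (isSkew_dispGen φ z) (span_expVec_dense φ)
    (c := fun t α => dispFactor z t α) (σ := fun t α => α + t * z)
    (inner_dispFactor_smul_expVec φ z) (dispFactor_zero z) (fun α => by simp)
    (dispFactor_add z) (fun s t α => by push_cast; ring)
    (continuous_dispFactor_smul_expVec φ z)
    (fun α => ⟨_, dispGen_expVec φ z α, by
      simpa [dispFactor_zero] using hasDerivAt_dispFactor_smul_expVec φ z 0 α⟩)
  exact ⟨h.1, fun α => by simpa [disp] using h.2.2 α⟩

end CoherentVectors

/-! ### Operators on `ℂⁿ ⊗ H` -/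

section Tensor

variable {H : Type*} [NormedAddCommGroup H] [InnerProductSpace ℂ H] {n : ℕ}

lemma inner_matOp (M : Matrix (Fin n) (Fin n) ℂ) (x y : EuclideanSpace ℂ (Fin n)) :
    inner ℂ (matOp M x) y = inner ℂ x (matOp Mᴴ y) := by
  rw [matOp, matOp, Matrix.toEuclideanLin_conjTranspose_eq_adjoint, LinearMap.adjoint_inner_right]

/-- `ℂⁿ ⊗ H` is the isometric image of the `ℓ²`-sum of `n` copies of `H` under
`(xⱼ) ↦ ∑ⱼ eⱼ ⊗ xⱼ`. -/
instance completeSpace_euclideanSpace_tensorProduct [CompleteSpace H] :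
    CompleteSpace (EuclideanSpace ℂ (Fin n) ⊗[ℂ] H) := by
  set e := EuclideanSpace.basisFun (Fin n) ℂ
  set f : PiLp 2 (fun _ : Fin n => H) →ₗ[ℂ] EuclideanSpace ℂ (Fin n) ⊗[ℂ] H :=
    ∑ j, TensorProduct.mk ℂ _ _ (e j) ∘ₗ (PiLp.proj 2 (fun _ : Fin n => H) j).toLinearMap with hf
  have hfa : ∀ x, f x = ∑ j, e j ⊗ₜ[ℂ] x j := fun x => by simp [hf]
  have hn : ∀ x, ‖f x‖ = ‖x‖ := by
    intro x
    apply norm_eq_of_inner_self_eq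
    simp only [hfa, sum_inner, inner_sum, TensorProduct.inner_tmul,
      orthonormal_iff_ite.1 e.orthonormal, PiLp.inner_apply]
    simp
  have hs : Function.Surjective f := by
    rw [← LinearMap.range_eq_top, ← top_le_iff, ← TensorProduct.span_tmul_eq_top,
      Submodule.span_le]
    rintro _ ⟨v, x, rfl⟩
    refine ⟨WithLp.toLp 2 fun j => e.repr v j • x, ?_⟩
    rw [hfa]
    conv_rhs => rw [← e.sum_repr v, TensorProduct.sum_tmul]
    exact Finset.sum_congr rfl fun j _ => by rw [TensorProduct.smul_tmul]
  have hiso : Isometry f := AddMonoidHomClass.isometry_of_norm f hn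
  exact (hiso.isUniformInducing.completeSpace_congr hs).1 inferInstance

lemma matTensor_apply (M : Matrix (Fin n) (Fin n) ℂ) (A : H →ₗ.[ℂ] H)
    (p : EuclideanSpace ℂ (Fin n) ⊗[ℂ] A.domain) :
    matTensor M A ⟨A.domain.subtype.lTensor (EuclideanSpace ℂ (Fin n)) p, p, rfl⟩ =
      TensorProduct.map (matOp M) A.toFun p := by
  change TensorProduct.map (matOp M) A.toFun ((LinearEquiv.ofInjective _ _).symm _) = _
  congr 1
  exact (LinearEquiv.symm_apply_eq _).2 rfl

variable (φ : HilbertBasis ℕ ℂ H)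

/-- The creation operator as a linear map on its domain. -/
def creatLin : ladderDomain φ →ₗ[ℂ] H := (creat φ).toFun

/-- The annihilation operator as a linear map on its domain. -/
def annihLin : ladderDomain φ →ₗ[ℂ] H := (annih φ).toFun

/-- The graph of `Z ⊗ a† - Z* ⊗ a`, parametrised by `ℂⁿ ⊗ dom a`. -/
lemma mem_graph_matDispGen {Z : Matrix (Fin n) (Fin n) ℂ}
    {q : (EuclideanSpace ℂ (Fin n) ⊗[ℂ] H) × (EuclideanSpace ℂ (Fin n) ⊗[ℂ] H)} :
    q ∈ (matDispGen φ Z).graph ↔ ∃ p : EuclideanSpace ℂ (Fin n) ⊗[ℂ] ladderDomain φ,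
      (ladderDomain φ).subtype.lTensor (EuclideanSpace ℂ (Fin n)) p = q.1 ∧
      TensorProduct.map (matOp Z) (creatLin φ) p - TensorProduct.map (matOp Zᴴ) (annihLin φ) p =
        q.2 := by
  have key : ∀ (p : EuclideanSpace ℂ (Fin n) ⊗[ℂ] ladderDomain φ) (h),
      matDispGen φ Z ⟨(ladderDomain φ).subtype.lTensor (EuclideanSpace ℂ (Fin n)) p, h⟩ =
        TensorProduct.map (matOp Z) (creatLin φ) p -
          TensorProduct.map (matOp Zᴴ) (annihLin φ) p := fun p h =>
    congrArg₂ (· - ·) (matTensor_apply Z (creat φ) p) (matTensor_apply Zᴴ (annih φ) p)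
  rw [LinearPMap.mem_graph_iff]
  constructor
  · rintro ⟨⟨x, hx⟩, h1, h2⟩
    obtain ⟨p, rfl⟩ := hx.1
    exact ⟨p, h1, (key p hx).symm.trans h2⟩
  · rintro ⟨p, h1, h2⟩
    exact ⟨⟨_, ⟨p, rfl⟩, ⟨p, rfl⟩⟩, h1, (key p _).trans h2⟩

/-- If `B` is a formal adjoint of `A`, then `M* ⊗ B` is a formal adjoint of `M ⊗ A`. -/
lemma inner_map_matOp {D : Submodule ℂ H} {A B : D →ₗ[ℂ] H}
    (hAB : ∀ x y : D, inner ℂ (A x) (y : H) = inner ℂ (x : H) (B y))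
    (M : Matrix (Fin n) (Fin n) ℂ) (p q : EuclideanSpace ℂ (Fin n) ⊗[ℂ] D) :
    inner ℂ (TensorProduct.map (matOp M) A p) (D.subtype.lTensor _ q) =
      inner ℂ (D.subtype.lTensor (EuclideanSpace ℂ (Fin n)) p)
        (TensorProduct.map (matOp Mᴴ) B q) := by
  induction p with
  | zero => simp
  | add p p' hp hp' => simp only [map_add, inner_add_left, hp, hp']
  | tmul v x =>
    induction q with
    | zero => simp
    | add q q' hq hq' => simp only [map_add, inner_add_right, hq, hq']
    | tmul w y =>
      simp only [TensorProduct.map_tmul, LinearMap.lTensor_tmul, TensorProduct.inner_tmul,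
        Submodule.subtype_apply, hAB, inner_matOp]

lemma isSkew_matDispGen (Z : Matrix (Fin n) (Fin n) ℂ) :
    IsSkew ((matDispGen φ Z).graph :
      Set ((EuclideanSpace ℂ (Fin n) ⊗[ℂ] H) × (EuclideanSpace ℂ (Fin n) ⊗[ℂ] H))) := by
  rintro ⟨x, y⟩ hq
  obtain ⟨p, rfl, rfl⟩ := (mem_graph_matDispGen φ).1 hq
  have e := inner_map_matOp (A := creatLin φ) (B := annihLin φ) (inner_creat φ) Z p p
  simp only
  rw [inner_sub_left, e, ← inner_conj_symm (TensorProduct.map (matOp Zᴴ) (annihLin φ) p)]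
  simp only [Complex.sub_re, Complex.conj_re, sub_self]

variable [CompleteSpace H] (b : OrthonormalBasis (Fin n) ℂ (EuclideanSpace ℂ (Fin n)))

lemma span_tmul_expVec_dense :
    (Submodule.span ℂ (Set.range fun i : Fin n × ℂ =>
      b i.1 ⊗ₜ[ℂ] expVec φ i.2)).topologicalClosure = ⊤ := by
  set K := (Submodule.span ℂ (Set.range fun i : Fin n × ℂ =>
      b i.1 ⊗ₜ[ℂ] expVec φ i.2)).topologicalClosure with hK
  have hb : ∀ j x, b j ⊗ₜ[ℂ] x ∈ K := by
    intro j x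
    have hle : (Submodule.span ℂ (Set.range (expVec φ))).topologicalClosure ≤
        K.comap (TensorProduct.mkL ℂ _ H (b j) : H →ₗ[ℂ] _) := by
      refine Submodule.topologicalClosure_minimal _ ?_ ?_
      · rw [Submodule.span_le]
        rintro _ ⟨α, rfl⟩
        exact Submodule.le_topologicalClosure _ (Submodule.subset_span ⟨(j, α), rfl⟩)
      · exact (Submodule.isClosed_topologicalClosure _).preimage
          (TensorProduct.mkL ℂ _ H (b j)).continuous
    rw [span_expVec_dense] at hle
    exact hle (Submodule.mem_top (x := x))
  rw [← top_le_iff, ← TensorProduct.span_tmul_eq_top, Submodule.span_le]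
  rintro _ ⟨v, x, rfl⟩
  rw [← b.sum_repr v, TensorProduct.sum_tmul]
  exact Submodule.sum_mem _ fun j _ => by
    rw [← TensorProduct.smul_tmul']
    exact Submodule.smul_mem _ _ (hb j x)

variable {b} {Z : Matrix (Fin n) (Fin n) ℂ} {z : Fin n → ℂ}

lemma matDispGen_tmul_expVec (hZ : ∀ j, matOp Z (b j) = z j • b j)
    (hZ' : ∀ j, matOp Zᴴ (b j) = conj (z j) • b j) (j : Fin n) (α : ℂ) :
    (b j ⊗ₜ[ℂ] expVec φ α, b j ⊗ₜ[ℂ] (z j • creat φ ⟨expVec φ α, expVec_mem_ladderDomain φ α⟩ -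
      (conj (z j) * α) • expVec φ α)) ∈ (matDispGen φ Z).graph := by
  refine (mem_graph_matDispGen φ).2
    ⟨b j ⊗ₜ[ℂ] ⟨expVec φ α, expVec_mem_ladderDomain φ α⟩, rfl, ?_⟩
  have ha : annihLin φ ⟨expVec φ α, expVec_mem_ladderDomain φ α⟩ = α • expVec φ α :=
    annih_expVec φ α
  rw [TensorProduct.map_tmul, TensorProduct.map_tmul, hZ, hZ', ha, TensorProduct.tmul_sub,
    TensorProduct.smul_tmul, TensorProduct.smul_tmul, smul_smul]
  rfl

/-- If `Z` is diagonalised by the orthonormal basis `b`, the group generated by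
`Z ⊗ a† - Z* ⊗ a` exists and acts on each summand `b j ⊗ H` as the displacement group of the
eigenvalue `z j`. -/
theorem matDisp_spec (hZ : ∀ j, matOp Z (b j) = z j • b j)
    (hZ' : ∀ j, matOp Zᴴ (b j) = conj (z j) • b j) :
    (∃! T : C0Group (EuclideanSpace ℂ (Fin n) ⊗[ℂ] H), T.IsGeneratedBy (matDispGen φ Z)) ∧
      (∃ U : (EuclideanSpace ℂ (Fin n) ⊗[ℂ] H) ≃ₗᵢ[ℂ] (EuclideanSpace ℂ (Fin n) ⊗[ℂ] H),
        ∀ x, matDisp φ Z x = U x) ∧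
      ∀ j x, matDisp φ Z (b j ⊗ₜ[ℂ] x) = b j ⊗ₜ[ℂ] disp φ (z j) x := by
  have h := exists_isGeneratedBy_of_flow (isSkew_matDispGen φ Z) (span_tmul_expVec_dense φ b)
    (c := fun t i => dispFactor (z i.1) t i.2) (σ := fun t i => (i.1, i.2 + t * z i.1))
    (fun t i j => by
      have hin := inner_dispFactor_smul_expVec φ (z j.1) t i.2 j.2
      rw [← TensorProduct.tmul_smul, ← TensorProduct.tmul_smul, TensorProduct.inner_tmul,
        TensorProduct.inner_tmul]
      by_cases hij : i.1 = j.1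
      · rw [hij, hin]
      · rw [orthonormal_iff_ite.1 b.orthonormal, if_neg hij, zero_mul, zero_mul])
    (fun i => dispFactor_zero _ _) (fun i => by simp)
    (fun s t i => dispFactor_add _ _ _ _) (fun s t i => by ext <;> simp; ring)
    (fun i => ((TensorProduct.mkL ℂ (EuclideanSpace ℂ (Fin n)) H (b i.1)).continuous.comp
      (continuous_dispFactor_smul_expVec φ (z i.1) i.2)).congr
        fun t => TensorProduct.tmul_smul _ _ _)
    (fun i => ⟨_, matDispGen_tmul_expVec φ hZ hZ' i.1 i.2,
      hasDerivAt_of_clm (TensorProduct.mkL ℂ (EuclideanSpace ℂ (Fin n)) H (b i.1))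
        (hasDerivAt_dispFactor_smul_expVec φ (z i.1) 0 i.2)
        (fun t => (TensorProduct.tmul_smul _ _ _).symm)
        (by simp [dispFactor_zero, TensorProduct.mkL_apply_apply])⟩)
  refine ⟨h.1, h.2.1, fun j x => ?_⟩
  have heq : (matDisp φ Z).comp (TensorProduct.mkL ℂ (EuclideanSpace ℂ (Fin n)) H (b j)) =
      (TensorProduct.mkL ℂ (EuclideanSpace ℂ (Fin n)) H (b j)).comp (disp φ (z j)) := by
    refine ContinuousLinearMap.ext_on
      (Submodule.dense_iff_topologicalClosure_eq_top.2 (span_expVec_dense φ)) ?_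
    rintro _ ⟨α, rfl⟩
    have h1 := h.2.2 (j, α)
    change matDisp φ Z (b j ⊗ₜ[ℂ] expVec φ α) = b j ⊗ₜ[ℂ] disp φ (z j) (expVec φ α)
    rw [(disp_spec φ (z j)).2, TensorProduct.tmul_smul]
    simpa [matDisp] using h1
  exact congrArg (fun L => L x) heq

end Tensor

/-! ### Normal matrices -/

section NormalMatrices

variable {n : ℕ}

lemma matOp_mul_apply (M N : Matrix (Fin n) (Fin n) ℂ) (x : EuclideanSpace ℂ (Fin n)) :
    matOp (M * N) x = matOp M (matOp N x) := by
  rw [matOp, Matrix.toEuclideanLin, Matrix.toLpLin_mul_same]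
  rfl

open Module.End in
/-- A normal matrix has an orthonormal basis of eigenvectors: its real and imaginary parts are
commuting symmetric operators, whose joint eigenspaces span. -/
lemma exists_orthonormalBasis_eigenvectors {Z : Matrix (Fin n) (Fin n) ℂ}
    (hZ : IsStarNormal Z) :
    ∃ (b : OrthonormalBasis (Fin n) ℂ (EuclideanSpace ℂ (Fin n))) (z : Fin n → ℂ),
      ∀ j, matOp Z (b j) = z j • b j := by
  classical
  set A : Matrix (Fin n) (Fin n) ℂ := Z + Zᴴ with hA
  set B : Matrix (Fin n) (Fin n) ℂ := Complex.I • (Z - Zᴴ) with hB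
  have hcomm : Zᴴ * Z = Z * Zᴴ := hZ.star_comm_self
  have hAs : (matOp A).IsSymmetric := Matrix.isSymmetric_toEuclideanLin_iff.2 (by
    rw [Matrix.IsHermitian, hA, Matrix.conjTranspose_add, Matrix.conjTranspose_conjTranspose,
      add_comm])
  have hBs : (matOp B).IsSymmetric := Matrix.isSymmetric_toEuclideanLin_iff.2 (by
    rw [Matrix.IsHermitian, hB, Matrix.conjTranspose_smul, Matrix.conjTranspose_sub,
      Matrix.conjTranspose_conjTranspose, ← neg_sub Z, smul_neg, ← neg_smul]
    simp)
  have hAB : Commute (matOp A) (matOp B) := by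
    have h : A * B = B * A := by
      simp only [hA, hB, Matrix.mul_smul, Matrix.smul_mul]
      congr 1
      simp only [Matrix.add_mul, Matrix.mul_sub, Matrix.sub_mul, Matrix.mul_add, hcomm]
      abel
    change matOp A ∘ₗ matOp B = matOp B ∘ₗ matOp A
    rw [matOp, matOp, Matrix.toEuclideanLin, ← Matrix.toLpLin_mul_same,
      ← Matrix.toLpLin_mul_same, h]
  -- discard the zero eigenspaces: a subordinate orthonormal basis needs a finite index type
  have hint := DirectSum.isInternal_ne_bot_iff.2 (hAs.directSum_isInternal_of_commute hBs hAB)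
  have horth := (hAs.orthogonalFamily_eigenspace_inf_eigenspace hBs).comp
    (Subtype.val_injective (p := fun i : ℂ × ℂ =>
      (eigenspace (matOp A) i.2 ⊓ eigenspace (matOp B) i.1) ≠ ⊥))
  have : Fintype {i : ℂ × ℂ // (eigenspace (matOp A) i.2 ⊓ eigenspace (matOp B) i.1) ≠ ⊥} :=
    iSupIndep.fintypeNeBotOfFiniteDimensional
      (hAs.directSum_isInternal_of_commute hBs hAB).submodule_iSupIndep
  have hn : Module.finrank ℂ (EuclideanSpace ℂ (Fin n)) = n := by simp
  set b := hint.subordinateOrthonormalBasis hn horth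
  have hmem := fun a => hint.subordinateOrthonormalBasis_subordinate hn a horth
  refine ⟨b, fun j => (1 / 2) * ((hint.subordinateOrthonormalBasisIndex hn j horth).1.2 -
    Complex.I * (hint.subordinateOrthonormalBasisIndex hn j horth).1.1), fun j => ?_⟩
  obtain ⟨h1, h2⟩ := hmem j
  have h1' := mem_eigenspace_iff.1 h1
  have h2' := mem_eigenspace_iff.1 h2
  have hZAB : Z = (1 / 2 : ℂ) • (A - Complex.I • B) := by
    rw [hA, hB, smul_smul, Complex.I_mul_I]
    module
  conv_lhs => rw [hZAB]
  rw [matOp, map_smul, map_sub, map_smul, LinearMap.smul_apply, LinearMap.sub_apply,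
    LinearMap.smul_apply, h1', h2', mul_smul, sub_smul, mul_smul]

/-- Polar form with the argument normalised to `[0, 2π)`. -/
lemma exists_polar (z : ℂ) : ∃ r θ : ℝ, 0 ≤ r ∧ θ ∈ Set.Ico 0 (2 * Real.pi) ∧
    (r : ℂ) * Complex.exp ((θ : ℂ) * Complex.I) = z := by
  refine ⟨‖z‖, toIcoMod Real.two_pi_pos 0 (Complex.arg z), norm_nonneg z, ?_, ?_⟩
  · simpa using toIcoMod_mem_Ico Real.two_pi_pos 0 (Complex.arg z)
  · rw [toIcoMod]
    have : (((Complex.arg z - toIcoDiv Real.two_pi_pos 0 (Complex.arg z) • (2 * Real.pi) : ℝ) :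
        ℂ)) * Complex.I = Complex.arg z * Complex.I -
          toIcoDiv Real.two_pi_pos 0 (Complex.arg z) • (2 * Real.pi * Complex.I) := by
      simp only [zsmul_eq_mul]
      push_cast
      ring
    rw [this, Complex.exp_periodic.sub_zsmul_eq, Complex.norm_mul_exp_arg_mul_I]

lemma exists_isNormalDecomp {Z : Matrix (Fin n) (Fin n) ℂ} (hZ : IsStarNormal Z) :
    ∃ V r θ, IsNormalDecomp Z V r θ := by
  obtain ⟨b, z, hb⟩ := exists_orthonormalBasis_eigenvectors hZ
  choose r θ hr hθ hz using fun j => exists_polar (z j)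
  have hp : polarC r θ = z := funext hz
  set V : Matrix (Fin n) (Fin n) ℂ := Matrix.of fun i j => b j i with hV
  have hVV : star V * V = 1 := by
    ext i j
    have h := orthonormal_iff_ite.1 b.orthonormal i j
    rw [PiLp.inner_apply] at h
    rw [Matrix.mul_apply, Matrix.one_apply, ← h]
    refine Finset.sum_congr rfl fun k _ => ?_
    simp [hV, Matrix.star_apply, mul_comm]
  have hU : V ∈ Matrix.unitaryGroup (Fin n) ℂ := Matrix.mem_unitaryGroup_iff'.2 hVV
  refine ⟨V, r, θ, hU, hr, hθ, ?_⟩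
  have hZV : Z * V = V * Matrix.diagonal z := by
    ext i j
    have h := congrArg (fun x : EuclideanSpace ℂ (Fin n) => x i) (hb j)
    rw [Matrix.mul_diagonal]
    simpa [hV, Matrix.mul_apply, Matrix.mulVec, dotProduct, mul_comm, matOp] using h
  rw [hp, ← hZV, Matrix.mul_assoc]
  have h := Matrix.mem_unitaryGroup_iff.1 hU
  rw [Matrix.star_eq_conjTranspose] at h
  rw [h, Matrix.mul_one]

variable {V : Matrix (Fin n) (Fin n) ℂ}

/-- The columns of a unitary matrix as an orthonormal basis. -/
lemma exists_orthonormalBasis_columns (hV : V ∈ Matrix.unitaryGroup (Fin n) ℂ) :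
    ∃ b : OrthonormalBasis (Fin n) ℂ (EuclideanSpace ℂ (Fin n)),
      ∀ j, b j = matOp V (EuclideanSpace.basisFun (Fin n) ℂ j) := by
  have h : matOp Vᴴ ∘ₗ matOp V = LinearMap.id := by
    have h' := Matrix.mem_unitaryGroup_iff'.1 hV
    rw [Matrix.star_eq_conjTranspose] at h'
    rw [matOp, matOp, Matrix.toEuclideanLin, ← Matrix.toLpLin_mul_same, h', Matrix.toLpLin_one]
  have hadj : matOp Vᴴ = LinearMap.adjoint (matOp V) :=
    Matrix.toEuclideanLin_conjTranspose_eq_adjoint V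
  have hin : ∀ x y, inner ℂ (matOp V x) (matOp V y) = inner ℂ x y := fun x y => by
    rw [← LinearMap.adjoint_inner_right, ← hadj]
    exact congrArg (fun L : _ →ₗ[ℂ] _ => inner ℂ x (L y)) h
  refine ⟨(EuclideanSpace.basisFun (Fin n) ℂ).map
    (((matOp V).isometryOfInner hin).toLinearIsometryEquiv rfl), fun j => ?_⟩
  rw [OrthonormalBasis.map_apply]
  rfl

lemma matOp_conjTranspose_matOp (hV : V ∈ Matrix.unitaryGroup (Fin n) ℂ)
    (x : EuclideanSpace ℂ (Fin n)) : matOp Vᴴ (matOp V x) = x := by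
  have h' := Matrix.mem_unitaryGroup_iff'.1 hV
  rw [Matrix.star_eq_conjTranspose] at h'
  rw [← LinearMap.comp_apply, matOp, matOp, Matrix.toEuclideanLin, ← Matrix.toLpLin_mul_same, h',
    Matrix.toLpLin_one, LinearMap.id_apply]

lemma matOp_diagonal_basisFun (d : Fin n → ℂ) (j : Fin n) :
    matOp (Matrix.diagonal d) (EuclideanSpace.basisFun (Fin n) ℂ j) =
      d j • EuclideanSpace.basisFun (Fin n) ℂ j := by
  ext i
  simp [matOp, Matrix.mulVec_diagonal]
  by_cases h : i = j <;> simp [h]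

lemma matOp_conj_diagonal (hV : V ∈ Matrix.unitaryGroup (Fin n) ℂ) (d : Fin n → ℂ) (j : Fin n) :
    matOp (V * Matrix.diagonal d * Vᴴ) (matOp V (EuclideanSpace.basisFun (Fin n) ℂ j)) =
      d j • matOp V (EuclideanSpace.basisFun (Fin n) ℂ j) := by
  rw [matOp_mul_apply, matOp_mul_apply, matOp_conjTranspose_matOp hV, matOp_diagonal_basisFun,
    map_smul]

lemma exp_conj_diagonal (hV : V ∈ Matrix.unitaryGroup (Fin n) ℂ) (c : ℂ) (d : Fin n → ℂ) :
    NormedSpace.exp (c • (V * Matrix.diagonal d * Vᴴ)) =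
      V * Matrix.diagonal (fun j => Complex.exp (c * d j)) * Vᴴ := by
  have h' := Matrix.mem_unitaryGroup_iff.1 hV
  rw [Matrix.star_eq_conjTranspose] at h'
  have hinv : V⁻¹ = Vᴴ := Matrix.inv_eq_right_inv h'
  have hu : IsUnit V := IsUnit.of_mul_eq_one _ h'
  have he : c • (V * Matrix.diagonal d * Vᴴ) = V * Matrix.diagonal (c • d) * V⁻¹ := by
    rw [hinv, Matrix.diagonal_smul, Matrix.mul_smul, Matrix.smul_mul]
  rw [he, Matrix.exp_conj V _ hu, Matrix.exp_diagonal, hinv, Complex.exp_eq_exp_ℂ]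
  congr 3
  funext j
  rw [Pi.coe_exp, Pi.smul_apply, smul_eq_mul]

lemma polarC_mul_conj (r θ : Fin n → ℝ) (j : Fin n) :
    polarC r θ j * conj (polarC r θ j) = ((r j ^ 2 : ℝ) : ℂ) := by
  rw [Complex.mul_conj, Complex.normSq_eq_norm_sq, polarC, norm_mul, Complex.norm_real,
    Complex.norm_exp_ofReal_mul_I, mul_one, Real.norm_eq_abs, sq_abs]

lemma trace_mul_conjTranspose_of_isNormalDecomp {Z : Matrix (Fin n) (Fin n) ℂ} {r θ : Fin n → ℝ}
    (h : IsNormalDecomp Z V r θ) : (Z * Zᴴ).trace = ((∑ j, r j ^ 2 : ℝ) : ℂ) := by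
  have h' := Matrix.mem_unitaryGroup_iff'.1 h.unitary
  rw [Matrix.star_eq_conjTranspose] at h'
  have hZ : Z * Zᴴ = V * (Matrix.diagonal (polarC r θ) * (Matrix.diagonal (polarC r θ))ᴴ) * Vᴴ := by
    conv_lhs => rw [h.eq]
    simp only [Matrix.conjTranspose_mul, Matrix.conjTranspose_conjTranspose, Matrix.mul_assoc]
    rw [← Matrix.mul_assoc Vᴴ V, h', Matrix.one_mul]
  rw [hZ, Matrix.trace_mul_cycle, h', Matrix.one_mul, Matrix.diagonal_conjTranspose,
    Matrix.diagonal_mul_diagonal, Matrix.trace_diagonal, Complex.ofReal_sum]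
  exact Finset.sum_congr rfl fun j _ => polarC_mul_conj r θ j

end NormalMatrices

/-! ### Vector coherent states -/

section VectorCoherentStates

variable {H : Type*} [NormedAddCommGroup H] [InnerProductSpace ℂ H] {n : ℕ}

lemma matOp_pow_eigenvector {Z : Matrix (Fin n) (Fin n) ℂ} {v : EuclideanSpace ℂ (Fin n)} {z : ℂ}
    (hv : matOp Z v = z • v) (k : ℕ) : matOp (Z ^ k) v = z ^ k • v := by
  induction k with
  | zero => simp [matOp]
  | succ k ih =>
    rw [pow_succ, matOp_mul_apply, hv, map_smul, ih, smul_smul, pow_succ']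

lemma diagOp_tmul_basisFun (B : Fin n → H →L[ℂ] H) (j : Fin n) (x : H) :
    diagOp B (EuclideanSpace.basisFun (Fin n) ℂ j ⊗ₜ[ℂ] x) =
      EuclideanSpace.basisFun (Fin n) ℂ j ⊗ₜ[ℂ] B j x := by
  rw [diagOp, LinearMap.sum_apply, Finset.sum_eq_single j]
  · rw [TensorProduct.map_tmul, ← Matrix.diagonal_single, matOp_diagonal_basisFun]
    simp
  · intro i _ hij
    rw [TensorProduct.map_tmul, ← Matrix.diagonal_single, matOp_diagonal_basisFun]
    simp [Ne.symm hij]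
  · simp

variable [CompleteSpace H] (φ : HilbertBasis ℕ ℂ H)
  {b : OrthonormalBasis (Fin n) ℂ (EuclideanSpace ℂ (Fin n))}
  {Z : Matrix (Fin n) (Fin n) ℂ} {z : Fin n → ℂ}

/-- Expanding `χ` in an eigenbasis of `Z` turns the series of the vector coherent state into a
finite sum of ordinary coherent series. -/
lemma hasSum_vcsTerm (hZ : ∀ j, matOp Z (b j) = z j • b j) (χ : EuclideanSpace ℂ (Fin n)) :
    HasSum (vcsTerm φ Z χ) (∑ j, b.repr χ j • b j ⊗ₜ[ℂ] expVec φ (z j)) := by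
  have h : ∀ j, HasSum (fun k => b.repr χ j • b j ⊗ₜ[ℂ] (expCoeff (z j) k • φ k))
      (b.repr χ j • b j ⊗ₜ[ℂ] expVec φ (z j)) := fun j =>
    ((TensorProduct.mkL ℂ (EuclideanSpace ℂ (Fin n)) H (b j)).hasSum
      (hasSum_expVec φ (z j))).const_smul _
  refine (hasSum_sum fun j (_ : j ∈ Finset.univ) => h j).congr_fun fun k => ?_
  rw [vcsTerm]
  conv_lhs => rw [← b.sum_repr χ]
  rw [map_sum, Finset.smul_sum, TensorProduct.sum_tmul]
  refine Finset.sum_congr rfl fun j _ => ?_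
  rw [map_smul, matOp_pow_eigenvector (hZ j), smul_smul, smul_smul, ← TensorProduct.smul_tmul',
    TensorProduct.tmul_smul, smul_smul, expCoeff]
  congr 1
  ring

end VectorCoherentStates

end VCS

end

theorem mainTheorem7 {H : Type*} [NormedAddCommGroup H] [InnerProductSpace ℂ H] [CompleteSpace H]
    (φ : HilbertBasis ℕ ℂ H) {n : ℕ}
    (χ : OrthonormalBasis (Fin n) ℂ (EuclideanSpace ℂ (Fin n)))
    (Z : Matrix (Fin n) (Fin n) ℂ) (hZ : IsStarNormal Z) :
    -- the coherent states are given by convergent series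
    (∀ i, Summable (VCS.vcsTerm φ Z (χ i))) ∧
    -- the exponential defining the matrix displacement operator exists and is unitary
    (∃! T : VCS.C0Group (EuclideanSpace ℂ (Fin n) ⊗[ℂ] H),
      T.IsGeneratedBy (VCS.matDispGen φ Z)) ∧
    (∃ U : (EuclideanSpace ℂ (Fin n) ⊗[ℂ] H) ≃ₗᵢ[ℂ] (EuclideanSpace ℂ (Fin n) ⊗[ℂ] H),
      ∀ x, VCS.matDisp φ Z x = U x) ∧
    -- so do those defining the usual displacement operators
    (∀ z : ℂ, ∃! T : VCS.C0Group H, T.IsGeneratedBy (VCS.dispGen φ z)) ∧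
    -- the two formulas, for every decomposition of `Z`, of which there is at least one
    (∃ V r θ, VCS.IsNormalDecomp Z V r θ) ∧
    ∀ V r θ, VCS.IsNormalDecomp Z V r θ →
      (∀ i, VCS.vcs φ Z (χ i) =
        VCS.matTensorId H (NormedSpace.exp (-(1 / 2 : ℂ) • (V * VCS.matT r * Vᴴ)))
          (VCS.matDisp φ Z (χ i ⊗ₜ[ℂ] φ 0))) ∧
      (VCS.matDisp φ Z :
          (EuclideanSpace ℂ (Fin n) ⊗[ℂ] H) →ₗ[ℂ] (EuclideanSpace ℂ (Fin n) ⊗[ℂ] H)) =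
        VCS.matTensorId H V ∘ₗ VCS.diagOp (fun j => VCS.disp φ (VCS.polarC r θ j)) ∘ₗ
          VCS.matTensorId H Vᴴ := by
  open VCS in
  have heig : ∀ V r θ, IsNormalDecomp Z V r θ →
      ∃ b : OrthonormalBasis (Fin n) ℂ (EuclideanSpace ℂ (Fin n)),
        (∀ j, b j = matOp V (EuclideanSpace.basisFun (Fin n) ℂ j)) ∧
        (∀ j, matOp Z (b j) = polarC r θ j • b j) ∧
        ∀ j, matOp Zᴴ (b j) = conj (polarC r θ j) • b j := by
    intro V r θ h
    obtain ⟨b, hb⟩ := exists_orthonormalBasis_columns h.unitary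
    refine ⟨b, hb, fun j => ?_, fun j => ?_⟩
    · rw [hb, h.eq, matOp_conj_diagonal h.unitary]
    · rw [hb, h.eq, Matrix.conjTranspose_mul, Matrix.conjTranspose_mul,
        Matrix.conjTranspose_conjTranspose, ← Matrix.mul_assoc, Matrix.diagonal_conjTranspose,
        matOp_conj_diagonal h.unitary]
      rfl
  have hdec := VCS.exists_isNormalDecomp hZ
  obtain ⟨V₀, r₀, θ₀, h₀⟩ := hdec
  obtain ⟨b₀, -, hb₀, hb₀'⟩ := heig V₀ r₀ θ₀ h₀
  have hspec := VCS.matDisp_spec φ hb₀ hb₀'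
  refine ⟨fun i => (VCS.hasSum_vcsTerm φ hb₀ (χ i)).summable, hspec.1, hspec.2.1,
    fun z => (VCS.disp_spec φ z).1, ⟨V₀, r₀, θ₀, h₀⟩, fun V r θ h => ?_⟩
  obtain ⟨b, hb, hbZ, hbZ'⟩ := heig V r θ h
  have hD := (VCS.matDisp_spec φ hbZ hbZ').2.2
  constructor
  · intro i
    -- `φ₀` is the coherent vector `e(0)`
    have hχ : χ i ⊗ₜ[ℂ] φ 0 = ∑ j, b.repr (χ i) j • b j ⊗ₜ[ℂ] VCS.expVec φ 0 := by
      conv_lhs => rw [← b.sum_repr (χ i), TensorProduct.sum_tmul, ← VCS.expVec_zero φ]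
      rfl
    rw [VCS.vcs, (VCS.hasSum_vcsTerm φ hbZ (χ i)).tsum_eq, hχ, map_sum, map_sum, Finset.smul_sum]
    refine Finset.sum_congr rfl fun j _ => ?_
    rw [map_smul, map_smul, hD, (VCS.disp_spec φ _).2, zero_add, TensorProduct.tmul_smul,
      map_smul, VCS.matTensorId, TensorProduct.map_tmul, VCS.matT, VCS.exp_conj_diagonal h.unitary,
      hb, VCS.matOp_conj_diagonal h.unitary, ← hb, LinearMap.id_apply, ← TensorProduct.smul_tmul',
      smul_smul, smul_smul, smul_smul,
      VCS.trace_mul_conjTranspose_of_isNormalDecomp h, VCS.dispFactor,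
      VCS.polarC_mul_conj]
    congr 1
    -- compare exponents: `∑ᵢ rᵢ² = aⱼ + rⱼ²`
    rw [mul_assoc, ← Complex.exp_add, mul_comm]
    congr 2
    push_cast
    ring
  · -- both sides are linear, so compare them on the vectors `b j ⊗ x`
    refine TensorProduct.ext (b.toBasis.ext fun j => LinearMap.ext fun x => ?_)
    have hVb : VCS.matOp Vᴴ (b j) = EuclideanSpace.basisFun (Fin n) ℂ j := by
      rw [hb, VCS.matOp_conjTranspose_matOp h.unitary]
    rw [b.coe_toBasis]
    change VCS.matDisp φ Z (b j ⊗ₜ[ℂ] x) = VCS.matTensorId H V (VCS.diagOp _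
      (VCS.matTensorId H Vᴴ (b j ⊗ₜ[ℂ] x)))
    rw [hD, VCS.matTensorId, VCS.matTensorId, TensorProduct.map_tmul, hVb,
      LinearMap.id_apply, VCS.diagOp_tmul_basisFun, TensorProduct.map_tmul, ← hb,
      LinearMap.id_apply]
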